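/- Let $d\ge 1$ be an integer and let $\mathcal A$ be an abelian category. All subcategories are full, closed under isomorphisms and closed under finite direct sums (in particular they contain the zero object). For an abelian category $\mathcal E$, a subcategory $\mathcal M\subseteq\mathcal E$ is called *$d$-cluster tilting* if every object of $\mathcal E$ is a quotient of an object of $\mathcal M$ and a subobject of an object of $\mathcal M$, $\mathcal M$ is functorially finite in $\mathcal E$, and $$\mathcal M=\{E\in\mathcal E\mid \operatorname{Ext}^i_{\mathcal E}(E,\mathcal M)=0 \text{ for } 0<i<d\}=\{E\in\mathcal E\mid \operatorname{Ext}^i_{\mathcal E}(\mathcal M,E)=0\text{ for } 0<i<d\}.$$ A *wide* subcategory of $\mathcal A$ is one closed under kernels, cokernels and extensions; it is itself an abelian category. Let $\mathcal M$ be a $d$-cluster tilting subcategory of $\mathcal A$. A complex $X_{d+1}\to X_d\to\cdots\to X_1\to X_0$ in $\mathcal M$ exhibits $X_{d+1}\to\cdots\to X_1$ as a *$d$-kernel* of $X_1\to X_0$ if $0\to\operatorname{Hom}(X,X_{d+1})\to\cdots\to\operatorname{Hom}(X,X_0)$ is exact for all $X\in\mathcal M$; *$d$-cokernels* are defined dually.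 Let $\mathcal W$ be a *$d$-wide* subcategory of $\mathcal M$, i.e. a subcategory $\mathcal W\subseteq\mathcal M$ such that - $\mathcal W$ is closed under direct summands; - $\mathcal W$ is closed under $d$-extensions: every exact sequence $0\to W\to E_d\to\cdots\to E_1\to W'\to 0$ in $\mathcal A$ with $W,W'\in\mathcal W$ is Yoneda equivalent to an exact sequence $0\to W\to W_d\to\cdots\to W_1\to W'\to 0$ with all $W_i\in\mathcal W$ (two such sequences are Yoneda equivalent if there is a third exact sequence with the same end terms that has morphisms to both of them which are the identity on the end terms); - every morphism in $\mathcal W$ has a $d$-kernel and a $d$-cokernel in $\mathcal M$ all of whose terms lie in $\mathcal W$. Then there exists a unique wide subcategory $\mathcal B$ of $\mathcal A$ such that $\mathcal W\subseteq\mathcal B$ and $\mathcal W$ is a $d$-cluster tilting subcategory of $\mathcal B$. Furthermore, $$\begin{aligned}\mathcal B&=\{A\in\mathcal A\mid \exists\ 0\to W_d\to\cdots\to W_1\to A\to 0 \text{ exact in }\mathcal A,\ W_i\in\mathcal W,\ 1\le i\le d\}\\&=\{A\in\mathcal A\mid \exists\ 0\to A\to W^1\to\cdots\to W^d\to 0\text{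 exact in }\mathcal A,\ W^i\in\mathcal W,\ 1\le i\le d\}.\end{aligned}$$ -/

import Mathlib

open CategoryTheory CategoryTheory.Limits

universe v u

namespace HigherWide

variable {C : Type u} [Category.{v} C]

section Exactness

variable [HasZeroMorphisms C]

/-- The sequence `0 ⟶ S₀ ⟶ S₁ ⟶ ⋯ ⟶ Sₙ ⟶ 0` is exact (used only for `1 ≤ n`): it is exact at
`S₁, …, Sₙ₋₁`, its first morphism is a monomorphism and its last morphism is an epimorphism. -/
structure IsBoundedExact {n : ℕ} (S : ComposableArrows C n) : Prop where
  exact : S.Exact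
  mono (hn : 1 ≤ n) : Mono (S.map' 0 1)
  epi (m : ℕ) (hm : m + 1 = n) : Epi (S.map' m (m + 1))

/-- The objects `E` that admit an exact sequence `0 ⟶ W_d ⟶ ⋯ ⟶ W_1 ⟶ E ⟶ 0` with all `W_i`
in `W`. -/
def resolvable (W : ObjectProperty C) (d : ℕ) : ObjectProperty C := fun E ↦
  ∃ S : ComposableArrows C d, IsBoundedExact S ∧ (∀ i : Fin d, W (S.obj i.castSucc)) ∧
    Nonempty (S.right ≅ E)

/-- The objects `E` that admit an exact sequence `0 ⟶ E ⟶ W^1 ⟶ ⋯ ⟶ W^d ⟶ 0` with all `W^i`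
in `W`. -/
def coresolvable (W : ObjectProperty C) (d : ℕ) : ObjectProperty C := fun E ↦
  ∃ S : ComposableArrows C d, IsBoundedExact S ∧ (∀ i : Fin d, W (S.obj i.succ)) ∧
    Nonempty (S.left ≅ E)

/-- An exact sequence `0 ⟶ Y ⟶ E_d ⟶ ⋯ ⟶ E_1 ⟶ X ⟶ 0` with `d` middle terms. The end terms are
identified with `Y` and `X` by chosen isomorphisms. -/
structure DExtension (d : ℕ) (X Y : C) where
  seq : ComposableArrows C (d + 1)
  isBoundedExact : IsBoundedExact seq
  leftIso : seq.left ≅ Y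
  rightIso : seq.right ≅ X

/-- A morphism of exact sequences that is the identity on the two end terms. -/
structure DExtension.Hom {d : ℕ} {X Y : C} (E F : DExtension d X Y) where
  map : E.seq ⟶ F.seq
  left_comm : ComposableArrows.app' map 0 ≫ F.leftIso.hom = E.leftIso.hom
  right_comm : ComposableArrows.app' map (d + 1) ≫ F.rightIso.hom = E.rightIso.hom

/-- Yoneda equivalence of exact sequences with the same end terms: there is a third such exact
sequence with morphisms to both of them that are the identity on the end terms. -/
def DExtension.YonedaEquiv {d : ℕ} {X Y : C} (E F : DExtension d X Y) : Prop :=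
  ∃ G : DExtension d X Y, Nonempty (DExtension.Hom G E) ∧ Nonempty (DExtension.Hom G F)

/-- `W` is closed under `d`-extensions: every exact sequence
`0 ⟶ Y ⟶ E_d ⟶ ⋯ ⟶ E_1 ⟶ X ⟶ 0` with `X` and `Y` in `W` is Yoneda equivalent to one in which
all the middle terms are in `W`. -/
def IsClosedUnderDExtensions (W : ObjectProperty C) (d : ℕ) : Prop :=
  ∀ ⦃X Y : C⦄, W X → W Y → ∀ E : DExtension d X Y,
    ∃ F : DExtension d X Y, E.YonedaEquiv F ∧ ∀ i : Fin d, W (F.seq.obj i.succ.castSucc)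

/-- For a sequence `S₀ ⟶ S₁ ⟶ ⋯ ⟶ Sₙ` in `M`: it is a complex, and
`0 ⟶ Hom(X, S₀) ⟶ Hom(X, S₁) ⟶ ⋯ ⟶ Hom(X, Sₙ)` is exact for all `X` in `M`. When `n = d + 1`,
this says that `S₀ ⟶ ⋯ ⟶ S_d` is a `d`-kernel in `M` of the morphism `S_d ⟶ S_{d+1}`. -/
structure IsLeftExactIn (M : ObjectProperty C) {n : ℕ} (S : ComposableArrows C n) : Prop where
  mem (i : Fin (n + 1)) : M (S.obj i)
  isComplex : S.IsComplex
  hom_injective (hn : 1 ≤ n) {X : C} (_ : M X) (g : X ⟶ S.obj' 0)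
    (_ : g ≫ S.map' 0 1 = 0) : g = 0
  hom_exact (i : ℕ) (hi : i + 2 ≤ n) {X : C} (_ : M X) (g : X ⟶ S.obj' (i + 1))
    (_ : g ≫ S.map' (i + 1) (i + 2) = 0) : ∃ h : X ⟶ S.obj' i, h ≫ S.map' i (i + 1) = g

/-- For a sequence `S₀ ⟶ S₁ ⟶ ⋯ ⟶ Sₙ` in `M`: it is a complex, and
`0 ⟶ Hom(Sₙ, X) ⟶ ⋯ ⟶ Hom(S₁, X) ⟶ Hom(S₀, X)` is exact for all `X` in `M`. When `n = d + 1`,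
this says that `S₁ ⟶ ⋯ ⟶ S_{d+1}` is a `d`-cokernel in `M` of the morphism `S₀ ⟶ S₁`. -/
structure IsRightExactIn (M : ObjectProperty C) {n : ℕ} (S : ComposableArrows C n) : Prop where
  mem (i : Fin (n + 1)) : M (S.obj i)
  isComplex : S.IsComplex
  hom_injective (m : ℕ) (hm : m + 1 = n) {X : C} (_ : M X) (g : S.obj' (m + 1) ⟶ X)
    (_ : S.map' m (m + 1) ≫ g = 0) : g = 0
  hom_exact (i : ℕ) (hi : i + 2 ≤ n) {X : C} (_ : M X) (g : S.obj' (i + 1) ⟶ X)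
    (_ : S.map' i (i + 1) ≫ g = 0) : ∃ h : S.obj' (i + 2) ⟶ X, S.map' (i + 1) (i + 2) ≫ h = g

/-- Every morphism in `W` has a `d`-kernel in `M` all of whose terms are in `W`. -/
def IsClosedUnderDKernels (M W : ObjectProperty C) (d : ℕ) : Prop :=
  ∀ ⦃X Y : C⦄ (f : X ⟶ Y), W X → W Y → ∃ S : ComposableArrows C (d + 1),
    IsLeftExactIn M S ∧ (∀ i, W (S.obj i)) ∧ Nonempty (Arrow.mk (S.map' d (d + 1)) ≅ Arrow.mk f)

/-- Every morphism in `W` has a `d`-cokernel in `M` all of whose terms are in `W`. -/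
def IsClosedUnderDCokernels (M W : ObjectProperty C) (d : ℕ) : Prop :=
  ∀ ⦃X Y : C⦄ (f : X ⟶ Y), W X → W Y → ∃ S : ComposableArrows C (d + 1),
    IsRightExactIn M S ∧ (∀ i, W (S.obj i)) ∧ Nonempty (Arrow.mk (S.map' 0 1) ≅ Arrow.mk f)

/-- `W` is a `d`-wide subcategory of `M`: a full subcategory of `M`, closed under finite direct
sums, direct summands, `d`-extensions, `d`-kernels and `d`-cokernels. -/
structure IsDWide (M W : ObjectProperty C) (d : ℕ) : Prop where
  le : W ≤ M
  containsZero : W.ContainsZero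
  isClosedUnderFiniteProducts : W.IsClosedUnderFiniteProducts
  isStableUnderRetracts : W.IsStableUnderRetracts
  dExtensions : IsClosedUnderDExtensions W d
  dKernels : IsClosedUnderDKernels M W d
  dCokernels : IsClosedUnderDCokernels M W d

/-- A wide subcategory: a full subcategory that contains zero and is closed under finite direct
sums, kernels, cokernels and extensions. -/
class IsWide (B : ObjectProperty C) : Prop extends B.ContainsZero,
  B.IsClosedUnderFiniteProducts, B.IsClosedUnderKernels, B.IsClosedUnderCokernels,
  B.IsClosedUnderExtensions

end Exactness

section ClusterTilting

variable [Abelian C]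

/-- `Extⁿ(X, Y) = 0`. (`HasExt.standard` says that the Ext groups, which are groups of morphisms in
the derived category, exist in the universe `max u v` without any assumption on `C`.) -/
def ExtVanishes (X Y : C) (n : ℕ) : Prop :=
  letI := HasExt.standard C
  Subsingleton (Abelian.Ext.{max u v} X Y n)

/-- `M` is a `d`-cluster tilting subcategory of the abelian category `C`: it is generating,
cogenerating, contravariantly finite, covariantly finite, and consists of the objects `E` with
`Extⁱ(E, M) = 0` for `0 < i < d`, and of those with `Extⁱ(M, E) = 0` for `0 < i < d`. -/
structure IsClusterTilting (M : ObjectProperty C) (d : ℕ) : Prop where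
  generating (E : C) : ∃ (X : C) (p : X ⟶ E), M X ∧ Epi p
  cogenerating (E : C) : ∃ (X : C) (j : E ⟶ X), M X ∧ Mono j
  contravariantlyFinite (E : C) : ∃ (X : C) (p : X ⟶ E), M X ∧
    ∀ (X' : C) (g : X' ⟶ E), M X' → ∃ h : X' ⟶ X, h ≫ p = g
  covariantlyFinite (E : C) : ∃ (X : C) (j : E ⟶ X), M X ∧
    ∀ (X' : C) (g : E ⟶ X'), M X' → ∃ h : X ⟶ X', j ≫ h = g
  iff_ext_left (E : C) : M E ↔ ∀ X : C, M X → ∀ i : ℕ, 0 < i → i < d → ExtVanishes E X i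
  iff_ext_right (E : C) : M E ↔ ∀ X : C, M X → ∀ i : ℕ, 0 < i → i < d → ExtVanishes X E i

/-- `B` is a wide subcategory of `C`, and `W` is contained in `B` and is a `d`-cluster tilting
subcategory of the abelian category `B`. The Ext groups are those of `B`. -/
def IsWideWithClusterTilting (B W : ObjectProperty C) (d : ℕ) : Prop :=
  ∃ _ : IsWide B, W ≤ B ∧ IsClusterTilting (C := B.FullSubcategory) (W.inverseImage B.ι) d

end ClusterTilting

end HigherWide

/-! Take for $\mathcal B$ the cokernels of morphisms in $\mathcal W$ (`IsPresented`). Since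
$\mathcal M$ generates and cogenerates, $d$-kernels and $d$-cokernels are exact sequences in
$\mathcal A$. Hence a cokernel of a morphism in $\mathcal W$ has a $\mathcal W$-coresolution with
$d$ terms, so it is a kernel of a morphism in $\mathcal W$, so it has a $\mathcal W$-resolution with
$d$ terms, so it is again such a cokernel. All these descriptions of $\mathcal B$ coincide.

Because $\operatorname{Ext}^i(\mathcal W,\mathcal W)=0$ for $0<i<d$, dimension shifting along a
resolution with $d$ terms gives $\operatorname{Ext}^1(\mathcal W,K)=0$ for its first syzygy $K$
(`HasResolution.subsingleton_ext`). So the resolution starts with a right $\mathcal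
W$-approximation, and dually on the left. Morphisms in $\mathcal B$ therefore lift to presentations,
which yields closure under cokernels and kernels. An extension in $\mathcal B$ is reduced to an
extension of objects of $\mathcal W$ by pulling back along an approximation and pushing out along
another.

Cluster tilting in $\mathcal B$ needs Ext vanishing there: positive degree classes are effaceable,
so vanishing descends from $\mathcal A$ (`subsingleton_ext_fullSubcategory`). Conversely, if the
relevant Ext groups of an object vanish, its approximation splits and it is a summand of an object
of $\mathcal W$. Uniqueness holds because $\mathcal W$ generates any competitor, whose objects are
then cokernels of morphisms in $\mathcal W$. -/

namespace CategoryTheory.Abelian.Ext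

/-! ### Effaceability and dimension shifting for Ext -/

open _root_.DerivedCategory HomologicalComplex

universe w

variable {C : Type u} [Category.{v} C] [Abelian C]

/-- A complex in nonpositive degrees that is quasi-isomorphic to a single object in degree `0` is
covered by its term in degree `0`. -/
lemma exists_single_to_of_isStrictlyLE {X : C} {K : CochainComplex C ℤ}
    (π : K ⟶ (single C (ComplexShape.up ℤ) 0).obj X) [K.IsStrictlyLE 0] [QuasiIsoAt π 0] :
    ∃ (E : C) (p : E ⟶ X) (t : (single C (ComplexShape.up ℤ) 0).obj E ⟶ K), Epi p ∧
      t ≫ π = (single C (ComplexShape.up ℤ) 0).map p := by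
  -- As $K^1=0$, all of $K^0$ consists of cycles, so $K^0$ surjects onto $H^0(K)\cong X$.
  let e := K.iCyclesIso 0 1 (by simp)
    ((K.isZero_of_isStrictlyLE 0 1 (by simp)).eq_of_tgt _ _)
  let β := K.homologyπ 0 ≫ homologyMap π 0 ≫ (singleObjHomologySelfIso _ _ _).hom
  have hβ : Epi β := by
    have : IsIso (homologyMap π 0) := by rwa [quasiIsoAt_iff_isIso_homologyMap] at *
    infer_instance
  have hα : Epi (e.inv ≫ β) := epi_comp _ _
  have : π.f 0 = (e.inv ≫ β) ≫ (singleObjXSelf (ComplexShape.up ℤ) 0 X).inv := by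
    rw [← cancel_epi e.hom, Category.assoc, e.hom_inv_id_assoc]
    dsimp only [e, β]
    rw [Category.assoc, Category.assoc, homologyπ_naturality_assoc,
      homologyπ_singleObjHomologySelfIso_hom_assoc,
      ← singleObjCyclesSelfIso_inv_iCycles, Iso.hom_inv_id_assoc]
    exact (cyclesMap_i π 0).symm
  refine ⟨K.X 0, e.inv ≫ β, mkHomFromSingle (𝟙 _) fun j hj ↦
    (K.isZero_of_isStrictlyLE 0 j (by simp at hj; lia)).eq_of_tgt _ _, hα, ?_⟩
  apply HomologicalComplex.from_single_hom_ext
  rw [comp_f, mkHomFromSingle_f, Category.assoc, this, single_map_f_self, Category.id_comp,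
    Category.assoc]

/-- Morphisms in the derived category from a single object in degree `0` to a complex in negative
degrees are effaceable. -/
lemma exists_epi_Q_map_comp_eq_zero [HasDerivedCategory.{w} C] {X : C} {L : CochainComplex C ℤ}
    (φ : Q.obj ((CochainComplex.singleFunctor C 0).obj X) ⟶ Q.obj L) (n : ℤ) (hn : n < 0)
    [L.IsStrictlyLE n] :
    ∃ (E : C) (p : E ⟶ X), Epi p ∧ Q.map ((CochainComplex.singleFunctor C 0).map p) ≫ φ = 0 := by
  -- Write `φ` as a roof $X\leftarrow K\to L$ with $K$ in nonpositive degrees; the cover $K^0\to X$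
  -- lifts to $K$, and $K^0\to L$ vanishes because $L^0=0$.
  obtain ⟨K, _, π, h, g, rfl⟩ := right_fac_of_isStrictlyLE φ 0
  rw [isIso_Q_map_iff_quasiIso] at h
  have hπ : ∃ (E : C) (p : E ⟶ X) (t : (CochainComplex.singleFunctor C 0).obj E ⟶ K), Epi p ∧
      t ≫ π = (CochainComplex.singleFunctor C 0).map p :=
    @exists_single_to_of_isStrictlyLE C _ _ X K π inferInstance (h.quasiIsoAt 0)
  obtain ⟨E, p, t, hp, ht⟩ := hπ
  have h₁ : t ≫ g = 0 := by
    apply HomologicalComplex.from_single_hom_ext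
    apply (L.isZero_of_isStrictlyLE n 0 hn).eq_of_tgt
  exact ⟨E, p, hp, by
    rw [← ht, Q.map_comp, Category.assoc, IsIso.hom_inv_id_assoc, ← Q.map_comp, h₁, Q.map_zero]⟩

/-- Positive degree classes are effaceable: they vanish after pulling back along some
epimorphism. -/
lemma exists_epi_comp_eq_zero [HasExt.{w} C] {X Y : C} {n : ℕ} (x : Ext X Y (n + 1)) :
    ∃ (E : C) (p : E ⟶ X), Epi p ∧ (mk₀ p).comp x (zero_add _) = 0 := by
  let := HasDerivedCategory.standard C
  -- The shift of `Y` by `n + 1` is represented by `Y` placed in degree `-(n + 1)`.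
  let i := ((singleFunctors C).shiftIso (n + 1) (-(n + 1)) 0 (by lia)).hom.app Y
  obtain ⟨E, p, hp, h⟩ := exists_epi_Q_map_comp_eq_zero
    (L := (CochainComplex.singleFunctor C (-(n + 1))).obj Y) (x.hom ≫ i) (-(n + 1)) (by lia)
  refine ⟨E, p, hp, ?_⟩
  ext
  rw [comp_hom, mk₀_hom, ShiftedHom.mk₀_comp, zero_hom]
  exact (cancel_mono i).1 (((Category.assoc _ _ _).trans h).trans Limits.zero_comp.symm)

section

variable [HasExt.{w} C]

lemma subsingleton_of_isZero_right (X : C) {Y : C} (hY : IsZero Y) (n : ℕ) :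
    Subsingleton (Ext X Y n) :=
  subsingleton_of_forall_eq 0 fun x ↦ by
    rw [← x.comp_mk₀_id, hY.eq_of_src (𝟙 Y) 0, mk₀_zero, comp_zero]

lemma subsingleton_of_isZero_left {X : C} (hX : IsZero X) (Y : C) (n : ℕ) :
    Subsingleton (Ext X Y n) :=
  subsingleton_of_forall_eq 0 fun x ↦ by
    rw [← x.mk₀_id_comp, hX.eq_of_src (𝟙 X) 0, mk₀_zero, zero_comp]

variable {S : ShortComplex C} (hS : S.ShortExact)
include hS

lemma subsingleton_X₃ {X : C} {n : ℕ} (h₂ : Subsingleton (Ext X S.X₂ n))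
    (h₁ : Subsingleton (Ext X S.X₁ (n + 1))) : Subsingleton (Ext X S.X₃ n) :=
  subsingleton_of_forall_eq 0 fun x ↦ by
    obtain ⟨y, rfl⟩ := covariant_sequence_exact₃ X hS x rfl (Subsingleton.elim _ _)
    rw [Subsingleton.elim y 0, zero_comp]

lemma subsingleton_X₁ {Y : C} {n : ℕ} (h₂ : Subsingleton (Ext S.X₂ Y n))
    (h₃ : Subsingleton (Ext S.X₃ Y (n + 1))) : Subsingleton (Ext S.X₁ Y n) :=
  subsingleton_of_forall_eq 0 fun x ↦ by
    obtain ⟨y, rfl⟩ := contravariant_sequence_exact₁ hS Y x (add_comm 1 n) (Subsingleton.elim _ _)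
    rw [Subsingleton.elim y 0, comp_zero]

lemma exists_lift_of_subsingleton {X : C} (h : Subsingleton (Ext X S.X₁ 1)) (g : X ⟶ S.X₃) :
    ∃ l : X ⟶ S.X₂, l ≫ S.g = g := by
  obtain ⟨y, hy⟩ := covariant_sequence_exact₃ X hS (mk₀ g) (zero_add 1) (Subsingleton.elim _ _)
  obtain ⟨l, rfl⟩ := (mk₀_bijective _ _).surjective y
  exact ⟨l, (mk₀_bijective _ _).injective (by rw [← mk₀_comp_mk₀, hy])⟩

lemma exists_extension_of_subsingleton {Y : C} (h : Subsingleton (Ext S.X₃ Y 1)) (g : S.X₁ ⟶ Y) :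
    ∃ l : S.X₂ ⟶ Y, S.f ≫ l = g := by
  obtain ⟨y, hy⟩ := contravariant_sequence_exact₁ hS Y (mk₀ g) (add_zero 1) (Subsingleton.elim _ _)
  obtain ⟨l, rfl⟩ := (mk₀_bijective _ _).surjective y
  exact ⟨l, (mk₀_bijective _ _).injective (by rw [← mk₀_comp_mk₀, hy])⟩

end

end CategoryTheory.Abelian.Ext

/-! ### Resolutions: spliced short exact sequences and long exact sequences -/

namespace HigherWide

variable {C : Type u} [Category.{v} C] [Abelian C]

/-- The objects admitting an exact sequence `0 ⟶ W_n ⟶ ⋯ ⟶ W_1 ⟶ E ⟶ 0` with `W_i` in `W`, defined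
by splicing short exact sequences. -/
def HasResolution (W : ObjectProperty C) : ℕ → ObjectProperty C
  | 0 => IsZero
  | n + 1 => fun E ↦ ∃ (K X : C) (i : K ⟶ X) (p : X ⟶ E) (w : i ≫ p = 0),
      (ShortComplex.mk i p w).ShortExact ∧ W X ∧ HasResolution W n K

/-- The objects admitting an exact sequence `0 ⟶ E ⟶ W^1 ⟶ ⋯ ⟶ W^n ⟶ 0` with `W^i` in `W`, defined
by splicing short exact sequences. -/
def HasCoresolution (W : ObjectProperty C) : ℕ → ObjectProperty C
  | 0 => IsZero
  | n + 1 => fun E ↦ ∃ (X K : C) (i : E ⟶ X) (p : X ⟶ K) (w : i ≫ p = 0),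
      (ShortComplex.mk i p w).ShortExact ∧ W X ∧ HasCoresolution W n K

variable {W : ObjectProperty C}

lemma HasResolution.of_iso {n : ℕ} {E F : C} (e : E ≅ F) (h : HasResolution W n E) :
    HasResolution W n F := by
  cases n with
  | zero => exact IsZero.of_iso h e.symm
  | succ n =>
    obtain ⟨K, X, i, p, w, hS, hX, hK⟩ := h
    have w' : i ≫ p ≫ e.hom = 0 := by rw [reassoc_of% w, zero_comp]
    let φ : ShortComplex.mk i p w ≅ ShortComplex.mk i (p ≫ e.hom) w' :=
      ShortComplex.isoMk (Iso.refl _) (Iso.refl _) e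
    exact ⟨K, X, i, p ≫ e.hom, w', ShortComplex.shortExact_of_iso φ hS, hX, hK⟩

lemma HasCoresolution.of_iso {n : ℕ} {E F : C} (e : E ≅ F) (h : HasCoresolution W n E) :
    HasCoresolution W n F := by
  cases n with
  | zero => exact IsZero.of_iso h e.symm
  | succ n =>
    obtain ⟨X, K, i, p, w, hS, hX, hK⟩ := h
    have w' : (e.inv ≫ i) ≫ p = 0 := by rw [Category.assoc, w, comp_zero]
    let φ : ShortComplex.mk i p w ≅ ShortComplex.mk (e.inv ≫ i) p w' :=
      ShortComplex.isoMk e (Iso.refl _) (Iso.refl _)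
    exact ⟨X, K, e.inv ≫ i, p, w', ShortComplex.shortExact_of_iso φ hS, hX, hK⟩

section ComposableArrows

variable {n : ℕ} (S : ComposableArrows C n)

lemma exact_of_forall_exact (h : ∀ (i : ℕ) (hi : i + 2 ≤ n),
    ∃ h : S.map' i (i + 1) ≫ S.map' (i + 1) (i + 2) = 0,
      (ShortComplex.mk (S.map' i (i + 1)) (S.map' (i + 1) (i + 2)) h).Exact) : S.Exact where
  zero i hi := (h i hi).choose
  exact i hi := (h i hi).choose_spec

/-- In an exact sequence `0 ⟶ S₀ ⟶ ⋯ ⟶ Sₙ`, the kernels are resolved by the preceding terms. -/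
lemma hasResolution_kernel (hS : S.Exact) (hmono : ∀ hn : 1 ≤ n, Mono (S.map' 0 1))
    (hW : ∀ (i : ℕ) (hi : i < n), W (S.obj' i)) (k : ℕ) (hk : k + 1 ≤ n) :
    HasResolution W k (kernel (S.map' k (k + 1))) := by
  induction k with
  | zero =>
    have := hmono hk
    exact isZero_kernel_of_mono _
  | succ k ih =>
    have hex := hS.exact k
    let p : S.obj' k ⟶ kernel (S.map' (k + 1) (k + 2)) :=
      kernel.lift _ (S.map' k (k + 1)) (hS.zero k)
    have hp : p ≫ kernel.ι _ = S.map' k (k + 1) := kernel.lift_ι _ _ _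
    refine ⟨_, _, kernel.ι (S.map' k (k + 1)), p, ?_, .mk' ?_ inferInstance ?_, hW k (by lia),
      ih (by lia)⟩
    · rw [← cancel_mono (kernel.ι _), Category.assoc, hp, kernel.condition, zero_comp]
    · rw [ShortComplex.exact_iff_exact_up_to_refinements]
      intro T x hx
      exact ⟨T, 𝟙 T, inferInstance, kernel.lift _ x (by
        rw [← hp, reassoc_of% hx, zero_comp]), by simp⟩
    · exact hex.epi_kernelLift

/-- In an exact sequence `S₀ ⟶ ⋯ ⟶ Sₙ ⟶ 0`, the cokernels are coresolved by the subsequent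
terms. -/
lemma hasCoresolution_cokernel (hS : S.Exact)
    (hepi : ∀ (m : ℕ) (hm : m + 1 = n), Epi (S.map' m (m + 1)))
    (hW : ∀ (i : ℕ) (hi : i < n), W (S.obj' (i + 1))) (k m : ℕ) (hk : m + 1 + k = n) :
    HasCoresolution W k (cokernel (S.map' m (m + 1))) := by
  induction k generalizing m with
  | zero =>
    have := hepi m hk
    exact isZero_cokernel_of_epi _
  | succ k ih =>
    have hex := hS.exact m
    let j : cokernel (S.map' m (m + 1)) ⟶ S.obj' (m + 2) :=
      cokernel.desc _ (S.map' (m + 1) (m + 2)) (hS.zero m)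
    have hj : cokernel.π _ ≫ j = S.map' (m + 1) (m + 2) := cokernel.π_desc _ _ _
    refine ⟨_, _, j, cokernel.π (S.map' (m + 1) (m + 2)), ?_, .mk' ?_ ?_ inferInstance,
      hW (m + 1) (by lia), ih (m + 1) (by lia)⟩
    · rw [← cancel_epi (cokernel.π _), reassoc_of% hj, cokernel.condition, comp_zero]
    · rw [ShortComplex.exact_iff_exact_up_to_refinements]
      intro T x hx
      obtain ⟨T', π, hπ, y, hy⟩ :=
        (ShortComplex.exact_cokernel (S.map' (m + 1) (m + 2))).exact_up_to_refinements x hx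
      exact ⟨T', π, hπ, y ≫ cokernel.π _, by simpa [hj] using hy⟩
    · exact hex.mono_cokernelDesc

end ComposableArrows

lemma hasResolution_of_resolvable {n : ℕ} {E : C} (h : resolvable W (n + 1) E) :
    HasResolution W (n + 1) E := by
  obtain ⟨S, hS, hW, ⟨e⟩⟩ := h
  have := hS.epi n rfl
  refine HasResolution.of_iso e ⟨_, _, kernel.ι (S.map' n (n + 1)), S.map' n (n + 1),
    kernel.condition _,
    .mk' (ShortComplex.exact_kernel _) inferInstance this, hW (Fin.last n),
    hasResolution_kernel S hS.exact hS.mono (fun i hi ↦ hW ⟨i, hi⟩) n le_rfl⟩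

lemma hasCoresolution_of_coresolvable {n : ℕ} {E : C} (h : coresolvable W (n + 1) E) :
    HasCoresolution W (n + 1) E := by
  obtain ⟨S, hS, hW, ⟨e⟩⟩ := h
  have := hS.mono (by lia)
  refine HasCoresolution.of_iso e ⟨_, _, S.map' 0 1, cokernel.π (S.map' 0 1),
    cokernel.condition _,
    .mk' (ShortComplex.exact_cokernel _) this inferInstance, hW 0,
    hasCoresolution_cokernel S hS.exact hS.epi (fun i hi ↦ hW ⟨i, hi⟩) n 0 (by lia)⟩

lemma exact_epi_comp {X Y Z : C} {f : X ⟶ Y} {g : Y ⟶ Z} {w : f ≫ g = 0}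
    (h : (ShortComplex.mk f g w).Exact) {T : C} (a : T ⟶ X) [Epi a] :
    ∃ w', (ShortComplex.mk (a ≫ f) g w').Exact := by
  refine ⟨by rw [Category.assoc, w, comp_zero], ?_⟩
  rw [ShortComplex.exact_iff_exact_up_to_refinements]
  intro T x hx
  obtain ⟨T₁, π₁, _, y, hy⟩ := h.exact_up_to_refinements x hx
  obtain ⟨T₂, π₂, _, z, hz⟩ := surjective_up_to_refinements_of_epi a y
  refine ⟨T₂, π₂ ≫ π₁, inferInstance, z, ?_⟩
  rw [Category.assoc π₂, hy]
  exact (reassoc_of% hz) f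

lemma exact_comp_mono {X Y Z : C} {f : X ⟶ Y} {g : Y ⟶ Z} {w : f ≫ g = 0}
    (h : (ShortComplex.mk f g w).Exact) {T : C} (a : Z ⟶ T) [Mono a] :
    ∃ w', (ShortComplex.mk f (g ≫ a) w').Exact := by
  refine ⟨by rw [reassoc_of% w, zero_comp], ?_⟩
  rw [ShortComplex.exact_iff_exact_up_to_refinements] at h ⊢
  exact fun T x hx ↦ h x (by
    rw [← cancel_mono a, zero_comp, Category.assoc]
    exact hx)

/-- Prepend an object to a sequence of objects. -/
def consObj (E : C) (X : ℕ → C) : ℕ → C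
  | 0 => E
  | i + 1 => X i

/-- Prepend a morphism to a descending sequence of morphisms. -/
def consDown {E : C} {X : ℕ → C} (a : X 0 ⟶ E) (f : ∀ i, X (i + 1) ⟶ X i) :
    ∀ i, consObj E X (i + 1) ⟶ consObj E X i
  | 0 => a
  | i + 1 => f i

/-- Prepend a morphism to an ascending sequence of morphisms. -/
def consUp {E : C} {X : ℕ → C} (a : E ⟶ X 0) (f : ∀ i, X i ⟶ X (i + 1)) :
    ∀ i, consObj E X i ⟶ consObj E X (i + 1)
  | 0 => a
  | i + 1 => f i

/-- A resolution as a sequence of objects and morphisms indexed by the natural numbers. -/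
lemma HasResolution.exists_sequence {n : ℕ} {E : C} (h : HasResolution W n E) :
    ∃ (X : ℕ → C) (a : X 0 ⟶ E) (f : ∀ i, X (i + 1) ⟶ X i), Epi a ∧
      (∀ i, ∃ w, (ShortComplex.mk (consDown a f (i + 1)) (consDown a f i) w).Exact) ∧
      (∀ i < n, W (X i)) ∧ ∀ i ≥ n, IsZero (X i) := by
  induction n generalizing E with
  | zero =>
    refine ⟨fun _ ↦ E, 0, fun _ ↦ 0, ⟨fun _ _ _ ↦ h.eq_of_src _ _⟩, fun i ↦ ?_, by simp,
      fun _ _ ↦ h⟩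
    refine ⟨by cases i <;> exact h.eq_of_src _ _, ShortComplex.exact_of_isZero_X₂ _ ?_⟩
    cases i <;> exact h
  | succ n ih =>
    obtain ⟨K, X, i, p, w, hS, hX, hK⟩ := h
    obtain ⟨Y, a, f, ha, hex, hY, hY'⟩ := ih hK
    have hi : Mono i := hS.mono_f
    refine ⟨consObj X Y, p, consDown (a ≫ i) f, hS.epi_g, ?_, ?_, ?_⟩
    · rintro (_ | _ | k)
      · exact exact_epi_comp hS.exact a
      · exact exact_comp_mono (Z := K) (hex 0).choose_spec i
      · exact hex (k + 1)
    · rintro (_ | k) hk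
      · exact hX
      · exact hY k (by lia)
    · rintro (_ | k) hk
      · simp at hk
      · exact hY' k (by lia)

/-- A coresolution as a sequence of objects and morphisms indexed by the natural numbers. -/
lemma HasCoresolution.exists_sequence {n : ℕ} {E : C} (h : HasCoresolution W n E) :
    ∃ (X : ℕ → C) (a : E ⟶ X 0) (f : ∀ i, X i ⟶ X (i + 1)), Mono a ∧
      (∀ i, ∃ w, (ShortComplex.mk (consUp a f i) (consUp a f (i + 1)) w).Exact) ∧
      (∀ i < n, W (X i)) ∧ ∀ i ≥ n, IsZero (X i) := by
  induction n generalizing E with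
  | zero =>
    refine ⟨fun _ ↦ E, 0, fun _ ↦ 0, ⟨fun _ _ _ ↦ h.eq_of_tgt _ _⟩, fun i ↦ ?_, by simp,
      fun _ _ ↦ h⟩
    exact ⟨h.eq_of_tgt _ _, ShortComplex.exact_of_isZero_X₂ _ h⟩
  | succ n ih =>
    obtain ⟨X, K, i, p, w, hS, hX, hK⟩ := h
    obtain ⟨Y, a, f, ha, hex, hY, hY'⟩ := ih hK
    have hp : Epi p := hS.epi_g
    refine ⟨consObj X Y, i, consUp (p ≫ a) f, hS.mono_f, ?_, ?_, ?_⟩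
    · rintro (_ | _ | k)
      · exact exact_comp_mono hS.exact a
      · exact exact_epi_comp (X := K) (hex 0).choose_spec p
      · exact hex (k + 1)
    · rintro (_ | k) hk
      · exact hX
      · exact hY k (by lia)
    · rintro (_ | k) hk
      · simp at hk
      · exact hY' k (by lia)

/-- The morphisms between consecutive terms of a descending sequence, with flexible indices. -/
noncomputable def stepDown {X : ℕ → C} (f : ∀ i, X (i + 1) ⟶ X i) (i j : ℕ) : X i ⟶ X j :=
  if h : i = j + 1 then eqToHom (by rw [h]) ≫ f j else 0

@[simp]
lemma stepDown_succ {X : ℕ → C} (f : ∀ i, X (i + 1) ⟶ X i) (j : ℕ) :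
    stepDown f (j + 1) j = f j := by
  simp [stepDown]

lemma HasResolution.resolvable {n : ℕ} {E : C} (h : HasResolution W (n + 1) E) :
    resolvable W (n + 1) E := by
  obtain ⟨X, a, f, ha, hex, hW, hzero⟩ := h.exists_sequence
  -- The augmented resolution has `E` at index `0` and descends, while composable arrows ascend;
  -- hence the reversal `n + 1 - i`.
  let S : ComposableArrows C (n + 1) := ComposableArrows.mkOfObjOfMapSucc
    (fun i ↦ consObj E X (n + 1 - i))
    (fun i ↦ stepDown (consDown a f) (n + 1 - i) (n + 1 - (i + 1)))
  have hS (i : ℕ) (hi : i < n + 1) : S.map' i (i + 1) =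
      stepDown (consDown a f) (n + 1 - i) (n + 1 - (i + 1)) :=
    ComposableArrows.mkOfObjOfMapSucc_map_succ _ _ i hi
  have hstep (i j k : ℕ) (hij : i = j + 1) (hjk : j = k + 1) :
      ∃ w, (ShortComplex.mk (stepDown (consDown a f) i j) (stepDown (consDown a f) j k) w).Exact := by
    subst hij hjk
    simpa using hex k
  refine ⟨S, ⟨exact_of_forall_exact S fun i hi ↦ ?_, fun _ ↦ ?_, fun m hm ↦ ?_⟩, fun i ↦ ?_,
    ⟨eqToIso ?_⟩⟩
  · rw [hS i (by lia), hS (i + 1) (by lia)]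
    exact hstep _ _ _ (by lia) (by lia)
  · rw [hS 0 (by lia)]
    -- The term one place beyond the length of the resolution is zero, so exactness there is
    -- injectivity.
    obtain ⟨w, h⟩ := hstep (n + 2) (n + 1) n rfl rfl
    refine h.mono_g ((hzero (n + 1) le_rfl).eq_of_src _ _)
  · obtain rfl : m = n := by lia
    rw [hS m (by lia)]
    have (i j : ℕ) (hi : i = 1) (hj : j = 0) : Epi (stepDown (consDown a f) i j) := by
      subst hi hj
      rw [stepDown_succ]
      exact ha
    exact this _ _ (by lia) (by lia)
  · change W (consObj E X (n + 1 - i))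
    obtain ⟨k, hk, hk'⟩ : ∃ k < n + 1, n + 1 - (i : ℕ) = k + 1 := ⟨n - i, by lia, by lia⟩
    rw [hk']
    exact hW k hk
  · change consObj E X (n + 1 - (n + 1)) = E
    rw [Nat.sub_self]
    rfl

lemma HasCoresolution.coresolvable {n : ℕ} {E : C} (h : HasCoresolution W (n + 1) E) :
    coresolvable W (n + 1) E := by
  obtain ⟨X, a, f, ha, hex, hW, hzero⟩ := h.exists_sequence
  let S : ComposableArrows C (n + 1) := ComposableArrows.mkOfObjOfMapSucc
    (fun i ↦ consObj E X i) (fun i ↦ consUp a f i)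
  have hS (i : ℕ) (hi : i < n + 1) : S.map' i (i + 1) = consUp a f i :=
    ComposableArrows.mkOfObjOfMapSucc_map_succ _ _ i hi
  refine ⟨S, ⟨exact_of_forall_exact S fun i hi ↦ ?_, fun _ ↦ ?_, fun m hm ↦ ?_⟩, fun i ↦ ?_,
    ⟨Iso.refl _⟩⟩
  · rw [hS i (by lia), hS (i + 1) (by lia)]
    exact hex i
  · rw [hS 0 (by lia)]
    exact ha
  · obtain rfl : m = n := by lia
    rw [hS m (by lia)]
    obtain ⟨w, h⟩ := hex m
    exact h.epi_f ((hzero (m + 1) le_rfl).eq_of_tgt _ _)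
  · exact hW i i.isLt

end HigherWide

/-! ### Presented and copresented objects, approximations, lifting to presentations -/

namespace HigherWide

variable {C : Type u} [Category.{v} C] [Abelian C]

/-- The cokernels of morphisms in `W`. -/
def IsPresented (W : ObjectProperty C) : ObjectProperty C := fun E ↦
  ∃ (X Y : C) (f : X ⟶ Y) (g : Y ⟶ E) (w : f ≫ g = 0),
    (ShortComplex.mk f g w).Exact ∧ Epi g ∧ W X ∧ W Y

/-- The kernels of morphisms in `W`. -/
def IsCopresented (W : ObjectProperty C) : ObjectProperty C := fun E ↦
  ∃ (X Y : C) (f : E ⟶ X) (g : X ⟶ Y) (w : f ≫ g = 0),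
    (ShortComplex.mk f g w).Exact ∧ Mono f ∧ W X ∧ W Y

variable {W : ObjectProperty C}

lemma IsPresented.of_mem [W.ContainsZero] {X : C} (hX : W X) : IsPresented W X := by
  obtain ⟨Z, hZ, hZ'⟩ := W.exists_prop_of_containsZero
  refine ⟨Z, X, 0, 𝟙 X, by simp, ?_, inferInstance, hZ', hX⟩
  exact (ShortComplex.exact_iff_mono _ rfl).2 (inferInstanceAs (Mono (𝟙 X)))

lemma HasResolution.exists_epi [W.ContainsZero] {n : ℕ} {K : C} (h : HasResolution W n K) :
    ∃ (X : C) (p : X ⟶ K), W X ∧ Epi p := by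
  cases n with
  | zero =>
    obtain ⟨Z, hZ, hZ'⟩ := W.exists_prop_of_containsZero
    exact ⟨Z, 0, hZ', ⟨fun _ _ _ ↦ h.eq_of_src _ _⟩⟩
  | succ n =>
    obtain ⟨_, X, _, p, _, hS, hX, _⟩ := h
    exact ⟨X, p, hX, hS.epi_g⟩

lemma HasCoresolution.exists_mono [W.ContainsZero] {n : ℕ} {K : C} (h : HasCoresolution W n K) :
    ∃ (X : C) (i : K ⟶ X), W X ∧ Mono i := by
  cases n with
  | zero =>
    obtain ⟨Z, hZ, hZ'⟩ := W.exists_prop_of_containsZero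
    exact ⟨Z, 0, hZ', ⟨fun _ _ _ ↦ h.eq_of_tgt _ _⟩⟩
  | succ n =>
    obtain ⟨X, _, i, _, _, hS, hX, _⟩ := h
    exact ⟨X, i, hX, hS.mono_f⟩

lemma HasResolution.isPresented [W.ContainsZero] {n : ℕ} {E : C}
    (h : HasResolution W (n + 1) E) : IsPresented W E := by
  obtain ⟨K, X, i, p, w, hS, hX, hK⟩ := h
  obtain ⟨Y, q, hY, hq⟩ := hK.exists_epi
  obtain ⟨w', h'⟩ := exact_epi_comp hS.exact q
  exact ⟨Y, X, q ≫ i, p, w', h', hS.epi_g, hY, hX⟩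

lemma HasCoresolution.isCopresented [W.ContainsZero] {n : ℕ} {E : C}
    (h : HasCoresolution W (n + 1) E) : IsCopresented W E := by
  obtain ⟨X, K, i, p, w, hS, hX, hK⟩ := h
  obtain ⟨Y, q, hY, hq⟩ := hK.exists_mono
  obtain ⟨w', h'⟩ := exact_comp_mono hS.exact q
  exact ⟨X, Y, i, p ≫ q, w', h', hS.mono_f, hX, hY⟩

section

variable {M : ObjectProperty C} {n : ℕ} {S : ComposableArrows C n}

/-- Exactness may be tested after an epimorphism, and every test object is covered by an object of
`M`. -/
lemma IsLeftExactIn.exact (hS : IsLeftExactIn M S)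
    (hM : ∀ E : C, ∃ (X : C) (p : X ⟶ E), M X ∧ Epi p) : S.Exact := by
  refine exact_of_forall_exact S fun i hi ↦ ⟨hS.isComplex.zero i, ?_⟩
  rw [ShortComplex.exact_iff_exact_up_to_refinements]
  intro T x hx
  obtain ⟨X, p, hX, hp⟩ := hM T
  obtain ⟨h, hh⟩ := hS.hom_exact i hi hX (p ≫ x) (by
    rw [Category.assoc]; exact hx ▸ comp_zero)
  exact ⟨X, p, hp, h, hh.symm⟩

lemma IsLeftExactIn.mono (hS : IsLeftExactIn M S)
    (hM : ∀ E : C, ∃ (X : C) (p : X ⟶ E), M X ∧ Epi p) (hn : 1 ≤ n) : Mono (S.map' 0 1) :=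
  Preadditive.mono_of_cancel_zero _ fun {T} x hx ↦ by
    obtain ⟨X, p, hX, hp⟩ := hM T
    rw [← cancel_epi p, comp_zero]
    exact hS.hom_injective hn hX _ (by rw [Category.assoc, hx, comp_zero])

/-- Embed the cokernel of one map into an object of `M`. Hom-exactness factors this embedding
through the map induced by the next arrow, which is therefore a monomorphism. -/
lemma IsRightExactIn.exact (hS : IsRightExactIn M S)
    (hM : ∀ E : C, ∃ (X : C) (j : E ⟶ X), M X ∧ Mono j) : S.Exact := by
  refine exact_of_forall_exact S fun i hi ↦ ⟨hS.isComplex.zero i, ?_⟩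
  rw [ShortComplex.exact_iff_mono_cokernel_desc]
  refine Preadditive.mono_of_cancel_zero _ fun {T} x hx ↦ ?_
  obtain ⟨X, j, hX, hj⟩ := hM (cokernel (S.map' i (i + 1)))
  obtain ⟨h, hh⟩ := hS.hom_exact i hi hX (cokernel.π _ ≫ j) (by
    rw [cokernel.condition_assoc, zero_comp])
  have hj' : cokernel.desc (S.map' i (i + 1)) (S.map' (i + 1) (i + 2)) (hS.isComplex.zero i) ≫ h
      = j := by
    rw [← cancel_epi (cokernel.π _), cokernel.π_desc_assoc, hh]
  rw [← cancel_mono j, zero_comp, ← hj']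
  exact (reassoc_of% hx) h |>.trans zero_comp

lemma IsRightExactIn.epi (hS : IsRightExactIn M S)
    (hM : ∀ E : C, ∃ (X : C) (j : E ⟶ X), M X ∧ Mono j) (m : ℕ) (hm : m + 1 = n) :
    Epi (S.map' m (m + 1)) :=
  Preadditive.epi_of_cancel_zero _ fun {T} x hx ↦ by
    obtain ⟨X, j, hX, hj⟩ := hM T
    rw [← cancel_mono j, zero_comp]
    exact hS.hom_injective m hm hX _ (by rw [reassoc_of% hx, zero_comp])

end

section

variable {M : ObjectProperty C} {n : ℕ} {E : C}

/-- In a `d`-cokernel of the presenting morphism, the terms after the first two number exactly `d`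
and coresolve its cokernel. -/
lemma IsPresented.hasCoresolution (h : IsPresented W E)
    (hM : ∀ E : C, ∃ (X : C) (j : E ⟶ X), M X ∧ Mono j) (hW : IsClosedUnderDCokernels M W n) :
    HasCoresolution W n E := by
  obtain ⟨X, Y, f, g, w, hex, hg, hX, hY⟩ := h
  obtain ⟨S, hS, hSW, ⟨e⟩⟩ := hW f hX hY
  have h := hasCoresolution_cokernel S (hS.exact hM) (hS.epi hM) (fun i hi ↦ hSW _) n 0 (by lia)
  let e₁ : cokernel (S.map' 0 1) ≅ cokernel f :=
    cokernel.mapIso _ _ (Arrow.leftFunc.mapIso e) (Arrow.rightFunc.mapIso e) e.hom.w.symm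
  exact h.of_iso (e₁ ≪≫ (cokernelIsCokernel f).coconePointUniqueUpToIso hex.gIsCokernel)

lemma IsCopresented.hasResolution (h : IsCopresented W E)
    (hM : ∀ E : C, ∃ (X : C) (p : X ⟶ E), M X ∧ Epi p) (hW : IsClosedUnderDKernels M W n) :
    HasResolution W n E := by
  obtain ⟨X, Y, f, g, w, hex, hf, hX, hY⟩ := h
  obtain ⟨S, hS, hSW, ⟨e⟩⟩ := hW g hX hY
  have h := hasResolution_kernel S (hS.exact hM) (hS.mono hM) (fun i hi ↦ hSW _) n (by lia)
  let e₁ : kernel (S.map' n (n + 1)) ≅ kernel g :=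
    kernel.mapIso _ _ (Arrow.leftFunc.mapIso e) (Arrow.rightFunc.mapIso e) e.hom.w.symm
  exact h.of_iso (e₁ ≪≫ (kernelIsKernel g).conePointUniqueUpToIso hex.fIsKernel)

end

section Ext

open CategoryTheory.Abelian

universe w

variable [HasExt.{w} C] {d n j : ℕ} {X K : C}

/-- Passing to the syzygy raises the degree by one and shortens the resolution by one, so the bound
on `j + n` is preserved until the syzygy is zero. -/
lemma HasResolution.subsingleton_ext (hK : HasResolution W n K)
    (h : ∀ Y, W Y → ∀ i : ℕ, 0 < i → i < d → Subsingleton (Ext X Y i))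
    (hj : 0 < j) (hjn : j + n ≤ d) : Subsingleton (Ext X K j) := by
  induction n generalizing K j with
  | zero => exact Ext.subsingleton_of_isZero_right X hK j
  | succ n ih =>
    obtain ⟨K', Y, i, p, w, hS, hY, hK'⟩ := hK
    exact Ext.subsingleton_X₃ hS (h Y hY j hj (by lia)) (ih hK' (by lia) (by lia))

lemma HasCoresolution.subsingleton_ext (hK : HasCoresolution W n K)
    (h : ∀ Y, W Y → ∀ i : ℕ, 0 < i → i < d → Subsingleton (Ext Y X i))
    (hj : 0 < j) (hjn : j + n ≤ d) : Subsingleton (Ext K X j) := by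
  induction n generalizing K j with
  | zero => exact Ext.subsingleton_of_isZero_left hK X j
  | succ n ih =>
    obtain ⟨Y, K', i, p, w, hS, hY, hK'⟩ := hK
    exact Ext.subsingleton_X₁ hS (h Y hY j hj (by lia)) (ih hK' (by lia) (by lia))

/-- A resolution of length `d` begins with an approximation of `E` by an object of `W`. -/
lemma HasResolution.exists_approximation (hE : HasResolution W (n + 1) E) :
    ∃ (Y : C) (p : Y ⟶ E), W Y ∧ Epi p ∧ ∀ X : C,
      (∀ Y, W Y → ∀ i : ℕ, 0 < i → i < n + 1 → Subsingleton (Ext X Y i)) →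
        ∀ g : X ⟶ E, ∃ h : X ⟶ Y, h ≫ p = g := by
  obtain ⟨K, Y, i, p, w, hS, hY, hK⟩ := hE
  exact ⟨Y, p, hY, hS.epi_g, fun X hX g ↦ Ext.exists_lift_of_subsingleton hS
    (hK.subsingleton_ext hX one_pos (by lia)) g⟩

/-- A coresolution of length `d` begins with an approximation of `E` by an object of `W`. -/
lemma HasCoresolution.exists_approximation (hE : HasCoresolution W (n + 1) E) :
    ∃ (Y : C) (i : E ⟶ Y), W Y ∧ Mono i ∧ ∀ X : C,
      (∀ Y, W Y → ∀ i : ℕ, 0 < i → i < n + 1 → Subsingleton (Ext Y X i)) →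
        ∀ g : E ⟶ X, ∃ h : Y ⟶ X, i ≫ h = g := by
  obtain ⟨Y, K, i, p, w, hS, hY, hK⟩ := hE
  exact ⟨Y, i, hY, hS.mono_f, fun X hX g ↦ Ext.exists_extension_of_subsingleton hS
    (hK.subsingleton_ext hX one_pos (by lia)) g⟩

end Ext

lemma prop_biprod_of_isClosedUnderFiniteProducts [W.IsClosedUnderFiniteProducts] {X Y : C}
    (hX : W X) (hY : W Y) : W (X ⊞ Y) :=
  W.prop_of_isLimit_binaryFan (BinaryBiproduct.isLimit X Y) hX hY

/-- The cokernel of a morphism of presented objects that lifts to the presentations. -/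
lemma IsPresented.of_exact_of_lift [W.IsClosedUnderFiniteProducts] {E F Q X Y Z : C} {g : E ⟶ F}
    {q : F ⟶ Q} {w : g ≫ q = 0} (hex : (ShortComplex.mk g q w).Exact) (hq : Epi q) (hX : W X)
    {a : X ⟶ E} (ha : Epi a) (hY : W Y) {b : Y ⟶ F} (hb : Epi b) (hZ : W Z) {f : Z ⟶ Y}
    {w' : f ≫ b = 0} (hex' : (ShortComplex.mk f b w').Exact) {h : X ⟶ Y} (hh : h ≫ b = a ≫ g) :
    IsPresented W Q := by
  refine ⟨Z ⊞ X, Y, biprod.desc f h, b ≫ q, ?_, ?_, inferInstance,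
    prop_biprod_of_isClosedUnderFiniteProducts hZ hX, hY⟩
  · ext
    · simp [reassoc_of% w']
    · simp [reassoc_of% hh, w]
  · rw [ShortComplex.exact_iff_exact_up_to_refinements]
    intro T x hx
    -- Modulo refinements, the image of `x` in `F` comes from `E`, hence from `X`; the remaining
    -- difference dies in `F` and so comes from `Z`.
    dsimp at x hx
    obtain ⟨T₁, π₁, _, y, hy⟩ := hex.exact_up_to_refinements (x ≫ b) (by simpa using hx)
    obtain ⟨T₂, π₂, _, z, hz⟩ := surjective_up_to_refinements_of_epi a y
    obtain ⟨T₃, π₃, _, t, ht⟩ := hex'.exact_up_to_refinements (π₂ ≫ π₁ ≫ x - z ≫ h) (by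
      dsimp at hy ⊢
      simp only [Preadditive.sub_comp, Category.assoc, hh, hy, reassoc_of% hz, sub_self])
    refine ⟨T₃, π₃ ≫ π₂ ≫ π₁, inferInstance, biprod.lift t (π₃ ≫ z), ?_⟩
    dsimp at ht ⊢
    rw [biprod.lift_desc, ← ht]
    simp

/-- The kernel of a morphism of copresented objects that extends to the copresentations. -/
lemma IsCopresented.of_exact_of_extension [W.IsClosedUnderFiniteProducts] {E F K X Y Z : C}
    {k : K ⟶ E} {g : E ⟶ F} {w : k ≫ g = 0} (hex : (ShortComplex.mk k g w).Exact) (hk : Mono k)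
    (hX : W X) {a : F ⟶ X} (ha : Mono a) (hY : W Y) {b : E ⟶ Y} (hb : Mono b) (hZ : W Z)
    {f : Y ⟶ Z} {w' : b ≫ f = 0} (hex' : (ShortComplex.mk b f w').Exact) {h : Y ⟶ X}
    (hh : b ≫ h = g ≫ a) : IsCopresented W K := by
  refine ⟨Y, Z ⊞ X, k ≫ b, biprod.lift f h, ?_, ?_, inferInstance, hY,
    prop_biprod_of_isClosedUnderFiniteProducts hZ hX⟩
  · ext
    · simp [w']
    · simp [hh, reassoc_of% w]
  · rw [ShortComplex.exact_iff_exact_up_to_refinements]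
    intro T x hx
    dsimp at x hx
    have hx₁ : x ≫ f = 0 := by simpa using hx =≫ biprod.fst
    have hx₂ : x ≫ h = 0 := by simpa using hx =≫ biprod.snd
    obtain ⟨y, hy⟩ := KernelFork.IsLimit.lift' hex'.fIsKernel x hx₁
    dsimp at hy
    obtain ⟨z, hz⟩ := KernelFork.IsLimit.lift' hex.fIsKernel y (by
      dsimp
      rw [← cancel_mono a, Category.assoc, ← hh, reassoc_of% hy, hx₂, zero_comp])
    dsimp at hz
    exact ⟨T, 𝟙 T, inferInstance, z, by dsimp; rw [Category.id_comp, reassoc_of% hz, hy]⟩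

end HigherWide

/-! ### The presented objects form a wide subcategory -/

namespace HigherWide

variable {C : Type u} [Category.{v} C] [Abelian C] {M W : ObjectProperty C} {n : ℕ}

/-- Going around the cycle: presented, coresolved, copresented, resolved, presented. -/
lemma IsDWide.isPresented_iff_hasResolution (hM : IsClusterTilting M (n + 1))
    (hW : IsDWide M W (n + 1)) {E : C} : IsPresented W E ↔ HasResolution W (n + 1) E := by
  have := hW.containsZero
  exact ⟨fun h ↦ (h.hasCoresolution hM.cogenerating hW.dCokernels).isCopresented.hasResolution
    hM.generating hW.dKernels, HasResolution.isPresented⟩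

lemma IsDWide.isPresented_iff_hasCoresolution (hM : IsClusterTilting M (n + 1))
    (hW : IsDWide M W (n + 1)) {E : C} : IsPresented W E ↔ HasCoresolution W (n + 1) E := by
  have := hW.containsZero
  exact ⟨fun h ↦ h.hasCoresolution hM.cogenerating hW.dCokernels, fun h ↦
    (h.isCopresented.hasResolution hM.generating hW.dKernels).isPresented⟩

lemma IsDWide.isPresented_iff_isCopresented (hM : IsClusterTilting M (n + 1))
    (hW : IsDWide M W (n + 1)) {E : C} : IsPresented W E ↔ IsCopresented W E := by
  have := hW.containsZero
  exact ⟨fun h ↦ (h.hasCoresolution hM.cogenerating hW.dCokernels).isCopresented, fun h ↦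
    (h.hasResolution hM.generating hW.dKernels).isPresented⟩

lemma IsDWide.subsingleton_ext (hM : IsClusterTilting M (n + 1)) (hW : IsDWide M W (n + 1))
    {X Y : C} (hX : W X) (hY : W Y) (i : ℕ) (hi : 0 < i) (hi' : i < n + 1) :
    letI := HasExt.standard C
    Subsingleton (Abelian.Ext.{max u v} X Y i) :=
  (hM.iff_ext_left X).1 (hW.le _ hX) Y (hW.le _ hY) i hi hi'

lemma IsDWide.exists_right_approximation (hM : IsClusterTilting M (n + 1))
    (hW : IsDWide M W (n + 1)) {E : C} (hE : IsPresented W E) :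
    ∃ (Y : C) (p : Y ⟶ E), W Y ∧ Epi p ∧ ∀ X : C, W X → ∀ g : X ⟶ E, ∃ h : X ⟶ Y, h ≫ p = g := by
  let := HasExt.standard C
  obtain ⟨Y, p, hY, hp, h⟩ :=
    ((hW.isPresented_iff_hasResolution hM).1 hE).exists_approximation
  exact ⟨Y, p, hY, hp, fun X hX ↦ h X fun Y hY ↦ hW.subsingleton_ext hM hX hY⟩

lemma IsDWide.exists_left_approximation (hM : IsClusterTilting M (n + 1))
    (hW : IsDWide M W (n + 1)) {E : C} (hE : IsPresented W E) :
    ∃ (Y : C) (i : E ⟶ Y), W Y ∧ Mono i ∧ ∀ X : C, W X → ∀ g : E ⟶ X, ∃ h : Y ⟶ X, i ≫ h = g := by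
  let := HasExt.standard C
  obtain ⟨Y, p, hY, hp, h⟩ :=
    ((hW.isPresented_iff_hasCoresolution hM).1 hE).exists_approximation
  exact ⟨Y, p, hY, hp, fun X hX ↦ h X fun Y hY ↦ hW.subsingleton_ext hM hY hX⟩

/-- The obstruction to lifting `X ⟶ E ⟶ F` to the cover `Y` of `F` lies in
$\operatorname{Ext}^1(X,K)$, which vanishes since `K` has a resolution of length `n`. -/
lemma IsDWide.isPresented_of_epi (hM : IsClusterTilting M (n + 1)) (hW : IsDWide M W (n + 1))
    {E F Q : C} {g : E ⟶ F} {q : F ⟶ Q} {w : g ≫ q = 0} (hex : (ShortComplex.mk g q w).Exact)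
    (hq : Epi q) (hE : IsPresented W E) (hF : IsPresented W F) : IsPresented W Q := by
  have := hW.isClosedUnderFiniteProducts
  have := hW.containsZero
  let := HasExt.standard C
  obtain ⟨X, a, hX, ha, -⟩ := hW.exists_right_approximation hM hE
  obtain ⟨K, Y, i, b, w', hS, hY, hK⟩ := (hW.isPresented_iff_hasResolution hM).1 hF
  obtain ⟨Z, p, hZ, hp⟩ := hK.exists_epi
  obtain ⟨w'', hex'⟩ := exact_epi_comp hS.exact p
  obtain ⟨h, hh⟩ := Abelian.Ext.exists_lift_of_subsingleton hS
    (hK.subsingleton_ext (fun Y hY ↦ hW.subsingleton_ext hM hX hY) one_pos (by lia)) (a ≫ g)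
  exact .of_exact_of_lift hex hq hX ha hY hS.epi_g hZ hex' hh

lemma IsDWide.isPresented_of_mono (hM : IsClusterTilting M (n + 1)) (hW : IsDWide M W (n + 1))
    {K E F : C} {k : K ⟶ E} {g : E ⟶ F} {w : k ≫ g = 0} (hex : (ShortComplex.mk k g w).Exact)
    (hk : Mono k) (hE : IsPresented W E) (hF : IsPresented W F) : IsPresented W K := by
  have := hW.isClosedUnderFiniteProducts
  have := hW.containsZero
  let := HasExt.standard C
  obtain ⟨X, a, hX, ha, -⟩ := hW.exists_left_approximation hM hF
  obtain ⟨Y, L, b, p, w', hS, hY, hL⟩ := (hW.isPresented_iff_hasCoresolution hM).1 hE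
  obtain ⟨Z, i, hZ, hi⟩ := hL.exists_mono
  obtain ⟨w'', hex'⟩ := exact_comp_mono hS.exact i
  obtain ⟨h, hh⟩ := Abelian.Ext.exists_extension_of_subsingleton hS
    (hL.subsingleton_ext (fun Y hY ↦ hW.subsingleton_ext hM hY hX) one_pos (by lia)) (g ≫ a)
  exact (hW.isPresented_iff_isCopresented hM).2
    (.of_exact_of_extension hex hk hX ha hY hS.mono_f hZ hex' hh)

/-- The short complex underlying an exact sequence with one middle term. -/
noncomputable abbrev DExtension.sc {X Y : C} (E : DExtension 1 X Y) : ShortComplex C :=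
  E.seq.sc E.isBoundedExact.exact.toIsComplex 0

lemma DExtension.shortExact_sc {X Y : C} (E : DExtension 1 X Y) : E.sc.ShortExact :=
  .mk' (E.isBoundedExact.exact.exact 0) (E.isBoundedExact.mono (by lia))
    (E.isBoundedExact.epi 1 rfl)

/-- Morphisms of short exact sequences that are the identity on the end terms are isomorphisms. -/
lemma DExtension.Hom.nonempty_iso {X Y : C} {E F : DExtension 1 X Y} (φ : E.Hom F) :
    Nonempty (E.seq.obj 1 ≅ F.seq.obj 1) := by
  let ψ : E.sc ⟶ F.sc := ComposableArrows.scMap φ.map _ _ 0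
  have h₁ : IsIso ψ.τ₁ := by
    have h : ψ.τ₁ ≫ F.leftIso.hom = E.leftIso.hom := φ.left_comm
    rw [← Iso.eq_comp_inv] at h
    rw [h]
    infer_instance
  have h₃ : IsIso ψ.τ₃ := by
    have h : ψ.τ₃ ≫ F.rightIso.hom = E.rightIso.hom := φ.right_comm
    rw [← Iso.eq_comp_inv] at h
    rw [h]
    infer_instance
  have := ShortComplex.isIso₂_of_shortExact_of_isIso₁₃ ψ E.shortExact_sc F.shortExact_sc
  exact ⟨asIso ψ.τ₂⟩

/-- A short exact sequence as an exact sequence with one middle term. -/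
noncomputable def DExtension.ofShortExact {S : ShortComplex C} (hS : S.ShortExact) :
    DExtension 1 S.X₃ S.X₁ where
  seq := S.toComposableArrows
  isBoundedExact :=
    { exact := hS.exact.exact_toComposableArrows
      mono := fun _ ↦ hS.mono_f
      epi := fun m hm ↦ by
        obtain rfl : m = 1 := by lia
        exact hS.epi_g }
  leftIso := Iso.refl _
  rightIso := Iso.refl _

/-- For `d = 1` this is closure under `d`-extensions, since Yoneda equivalent short exact sequences
have isomorphic middle terms. For `d ≥ 2` the sequence splits, as $\operatorname{Ext}^1$ vanishes.
-/
lemma IsDWide.prop_X₂_of_shortExact (hM : IsClusterTilting M (n + 1))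
    (hW : IsDWide M W (n + 1)) {S : ShortComplex C} (hS : S.ShortExact) (h₁ : W S.X₁)
    (h₃ : W S.X₃) : W S.X₂ := by
  have := hW.isClosedUnderFiniteProducts
  have := hW.isStableUnderRetracts
  cases n with
  | zero =>
    obtain ⟨F, ⟨G, ⟨φ⟩, ⟨ψ⟩⟩, hF⟩ := hW.dExtensions h₃ h₁ (.ofShortExact hS)
    obtain ⟨e⟩ := φ.nonempty_iso
    obtain ⟨e'⟩ := ψ.nonempty_iso
    exact W.prop_of_iso (e'.symm ≪≫ e) (hF 0)
  | succ n =>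
    let := HasExt.standard C
    obtain ⟨r, hr⟩ := Abelian.Ext.exists_extension_of_subsingleton hS
      (hW.subsingleton_ext hM h₃ h₁ 1 one_pos (by lia)) (𝟙 S.X₁)
    have σ := ShortComplex.Splitting.ofExactOfRetraction S hS.exact r hr hS.epi_g
    exact W.prop_of_iso σ.isoBinaryBiproduct.symm
      (prop_biprod_of_isClosedUnderFiniteProducts h₁ h₃)

/-- The pushout `Q` of the pullback `P` is an extension of objects of `W`. Then `P` is the kernel of
`Q ⟶ cokernel j`, and `S.X₂` is the cokernel of `kernel p ⟶ P`, so closure under kernels and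
cokernels finishes. -/
lemma IsDWide.isPresented_X₂_of_shortExact (hM : IsClusterTilting M (n + 1))
    (hW : IsDWide M W (n + 1)) {S : ShortComplex C} (hS : S.ShortExact)
    (h₁ : IsPresented W S.X₁) (h₃ : IsPresented W S.X₃) : IsPresented W S.X₂ := by
  have := hW.containsZero
  have := hS.mono_f
  have := hS.epi_g
  obtain ⟨X, p, hX, hp, -⟩ := hW.exists_right_approximation hM h₃
  obtain ⟨Y, j, hY, hj, -⟩ := hW.exists_left_approximation hM h₁
  -- the extension of `X` by `S.X₁` obtained by pulling back along `p`
  let i : S.X₁ ⟶ pullback S.g p := pullback.lift S.f 0 (by simp)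
  have hi₁ : i ≫ pullback.fst S.g p = S.f := pullback.lift_fst _ _ _
  have hi₂ : i ≫ pullback.snd S.g p = 0 := pullback.lift_snd _ _ _
  have : Mono i := mono_of_mono_fac hi₁
  have hlift {T : C} (x : T ⟶ pullback S.g p) (hx : x ≫ pullback.snd S.g p = 0) :
      ∃ y, y ≫ i = x := by
    obtain ⟨y, hy⟩ := KernelFork.IsLimit.lift' hS.fIsKernel (x ≫ pullback.fst S.g p) (by
      rw [Category.assoc, pullback.condition, reassoc_of% hx, zero_comp])
    dsimp at hy
    exact ⟨y, by ext <;> simp [hi₁, hi₂, hy, hx]⟩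
  -- the extension of `X` by `Y` obtained by pushing out along `j`
  have sq := IsPushout.of_hasPushout i j
  let q : pushout i j ⟶ X := pushout.desc (pullback.snd S.g p) 0 (by simp [hi₂])
  have hq₁ : pushout.inl i j ≫ q = pullback.snd S.g p := pushout.inl_desc _ _ _
  have hq₂ : pushout.inr i j ≫ q = 0 := pushout.inr_desc _ _ _
  have : Epi q := epi_of_epi_fac hq₁
  have hQ : W (pushout i j) := by
    refine hW.prop_X₂_of_shortExact hM (S := .mk _ _ hq₂) (.mk' ?_ (by dsimp; infer_instance)
      (by dsimp; infer_instance)) hY hX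
    rw [ShortComplex.exact_iff_exact_up_to_refinements]
    intro T x hx
    dsimp at x hx
    obtain ⟨T', π, _, y, z, hyz⟩ := sq.hom_eq_add_up_to_refinements x
    obtain ⟨y', rfl⟩ := hlift y (by
      simpa [hx, hq₁, hq₂] using (hyz =≫ q).symm)
    exact ⟨T', π, inferInstance, y' ≫ j + z, by
      dsimp
      rw [hyz, Preadditive.add_comp, Category.assoc, Category.assoc, pushout.condition]⟩
  let r : pushout i j ⟶ cokernel j := pushout.desc 0 (cokernel.π j) (by simp)
  have hr₁ : pushout.inl i j ≫ r = 0 := pushout.inl_desc _ _ _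
  have hr₂ : pushout.inr i j ≫ r = cokernel.π j := pushout.inr_desc _ _ _
  have hcoker : IsPresented W (cokernel j) :=
    hW.isPresented_of_epi hM (ShortComplex.exact_cokernel j) inferInstance h₁ (.of_mem hY)
  have hP : IsPresented W (pullback S.g p) := by
    refine hW.isPresented_of_mono hM (w := hr₁) ?_ inferInstance (.of_mem hQ) hcoker
    rw [ShortComplex.exact_iff_exact_up_to_refinements]
    intro T x hx
    dsimp at x hx
    obtain ⟨T', π, _, y, z, hyz⟩ := sq.hom_eq_add_up_to_refinements x
    obtain ⟨T'', π', _, z', hz'⟩ := (ShortComplex.exact_cokernel j).exact_up_to_refinements z (by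
      simpa [hx, hr₁, hr₂] using (hyz =≫ r).symm)
    exact ⟨T'', π' ≫ π, inferInstance, π' ≫ y + z' ≫ i, by
      dsimp at hz' ⊢
      simp only [Category.assoc, hyz, Preadditive.comp_add, Preadditive.add_comp,
        pushout.condition, reassoc_of% hz']⟩
  have hker : IsPresented W (kernel p) :=
    hW.isPresented_of_mono hM (ShortComplex.exact_kernel p) inferInstance (.of_mem hX) h₃
  let k : kernel p ⟶ pullback S.g p := pullback.lift 0 (kernel.ι p) (by simp)
  have hk₁ : k ≫ pullback.fst S.g p = 0 := pullback.lift_fst _ _ _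
  have hk₂ : k ≫ pullback.snd S.g p = kernel.ι p := pullback.lift_snd _ _ _
  refine hW.isPresented_of_epi hM (w := hk₁) ?_ inferInstance hker hP
  rw [ShortComplex.exact_iff_exact_up_to_refinements]
  intro T x hx
  dsimp at x hx
  refine ⟨T, 𝟙 T, inferInstance, kernel.lift p (x ≫ pullback.snd S.g p) (by
    rw [Category.assoc, ← pullback.condition, reassoc_of% hx, zero_comp]), ?_⟩
  dsimp
  ext
  · simp [hk₁, hx]
  · simp [hk₂]

lemma IsDWide.isWide (hM : IsClusterTilting M (n + 1)) (hW : IsDWide M W (n + 1)) :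
    IsWide (IsPresented W) := by
  have := hW.containsZero
  have hext : (IsPresented W).IsClosedUnderExtensions :=
    ⟨fun hS h₁ h₃ ↦ hW.isPresented_X₂_of_shortExact hM hS h₁ h₃⟩
  have hzero : (IsPresented W).ContainsZero := by
    obtain ⟨Z, hZ, hZ'⟩ := W.exists_prop_of_containsZero
    exact ⟨⟨Z, hZ, .of_mem hZ'⟩⟩
  have hiso : (IsPresented W).IsClosedUnderIsomorphisms := ⟨fun e h ↦
    (hW.isPresented_iff_hasResolution hM).2 (((hW.isPresented_iff_hasResolution hM).1 h).of_iso e)⟩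
  have hprod : (IsPresented W).IsClosedUnderBinaryProducts :=
    ⟨by
      rintro X ⟨p⟩
      have e : p.diag.obj ⟨.left⟩ ⊞ p.diag.obj ⟨.right⟩ ≅ X :=
        (BinaryBiproduct.isLimit _ _).conePointUniqueUpToIso
          (((IsLimit.postcomposeHomEquiv (diagramIsoPair p.diag) _).symm p.isLimit))
      -- A biproduct is a split extension of its summands.
      exact (IsPresented W).prop_of_iso e
        ((IsPresented W).prop_biprod (p.prop_diag_obj _) (p.prop_diag_obj _))⟩
  have hfin : (IsPresented W).IsClosedUnderFiniteProducts := .mk'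
  have hker : (IsPresented W).IsClosedUnderKernels := ⟨by
    rintro _ ⟨f, k, hk, hf⟩
    exact hW.isPresented_of_mono hM (ShortComplex.exact_of_f_is_kernel (.mk k.ι f k.condition)
      (hk.ofIsoLimit (Fork.ext (Iso.refl _)))) (Fork.IsLimit.mono hk) hf.1 hf.2⟩
  have hcoker : (IsPresented W).IsClosedUnderCokernels := ⟨by
    rintro _ ⟨f, k, hk, hf⟩
    exact hW.isPresented_of_epi hM (ShortComplex.exact_of_g_is_cokernel (.mk f k.π k.condition)
      (hk.ofIsoColimit (Cofork.ext (Iso.refl _)))) (Cofork.IsColimit.epi hk) hf.1 hf.2⟩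
  exact {}

end HigherWide

/-! ### Ext in a wide subcategory, cluster tilting and uniqueness -/

namespace HigherWide

variable {C : Type u} [Category.{v} C] [Abelian C]

section FullSubcategory

variable {W P : ObjectProperty C} [hP : IsWide P]

instance : P.ι.PreservesHomology where
  preservesKernels := P.preservesKernels_ι
  preservesCokernels := P.preservesCokernels_ι

lemma map_ι_shortExact {S : ShortComplex P.FullSubcategory} (hS : S.ShortExact) :
    (S.map P.ι).ShortExact := by
  have := hS.mono_f
  have := hS.epi_g
  have := P.preservesMonomorphisms_ι_of_isNormalEpiCategory
  have := P.preservesEpimorphisms_ι_of_isNormalMonoCategory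
  exact hS.map P.ι

lemma shortExact_of_map_ι {S : ShortComplex P.FullSubcategory} (hS : (S.map P.ι).ShortExact) :
    S.ShortExact :=
  ShortExact.reflects_shortExact_of_faithful P.ι hS

/-- The syzygies are kernels of morphisms in `P`, so the resolution never leaves `P`. -/
lemma HasResolution.fullSubcategory (hWP : W ≤ P) {n : ℕ} {E : P.FullSubcategory}
    (hE : HasResolution W n E.obj) : HasResolution (W.inverseImage P.ι) n E := by
  induction n generalizing E with
  | zero => exact IsZero.of_full_of_faithful_of_isZero P.ι E hE
  | succ n ih =>
    obtain ⟨K, X, i, p, w, hS, hX, hK⟩ := hE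
    let X' : P.FullSubcategory := ⟨X, hWP _ hX⟩
    let K' : P.FullSubcategory :=
      ⟨K, P.prop_of_isLimit_kernelFork hS.fIsKernel X'.property E.property⟩
    exact ⟨K', X', P.homMk i, P.homMk p, P.hom_ext w, shortExact_of_map_ι hS, hX, ih hK⟩

lemma HasCoresolution.fullSubcategory (hWP : W ≤ P) {n : ℕ} {E : P.FullSubcategory}
    (hE : HasCoresolution W n E.obj) : HasCoresolution (W.inverseImage P.ι) n E := by
  induction n generalizing E with
  | zero => exact IsZero.of_full_of_faithful_of_isZero P.ι E hE
  | succ n ih =>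
    obtain ⟨X, K, i, p, w, hS, hX, hK⟩ := hE
    let X' : P.FullSubcategory := ⟨X, hWP _ hX⟩
    let K' : P.FullSubcategory :=
      ⟨K, P.prop_of_isColimit_cokernelCofork hS.gIsCokernel E.property X'.property⟩
    exact ⟨X', K', P.homMk i, P.homMk p, P.hom_ext w, shortExact_of_map_ι hS, hX, ih hK⟩

section Ext

open CategoryTheory.Abelian

universe w w'

variable [HasExt.{w} C] [HasExt.{w'} P.FullSubcategory]

/-- Vanishing of Ext groups descends to a wide subcategory when there are enough objects with
vanishing Ext groups. -/
lemma subsingleton_ext_fullSubcategory {Y : P.FullSubcategory} {d n : ℕ}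
    (hgen : ∀ E : P.FullSubcategory, ∃ (X : P.FullSubcategory) (p : X ⟶ E), W X.obj ∧ Epi p)
    (hY : ∀ X, W X → ∀ i : ℕ, 0 < i → i < d → Subsingleton (Ext X Y.obj i)) (hn : n + 1 < d)
    {E : P.FullSubcategory} (hE : Subsingleton (Ext E.obj Y.obj (n + 1))) :
    Subsingleton (Ext E Y (n + 1)) := by
  induction n generalizing E with
  | zero =>
    refine subsingleton_of_forall_eq 0 fun x ↦ ?_
    obtain ⟨F, p, hp, hx⟩ := Ext.exists_epi_comp_eq_zero x
    let S : ShortComplex P.FullSubcategory := .mk _ _ (kernel.condition p)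
    have hS : S.ShortExact := .mk' (ShortComplex.exact_kernel p) inferInstance hp
    -- The class is the connecting image of a morphism `kernel p ⟶ Y`. It extends to `F` because
    -- $\operatorname{Ext}^1$ vanishes in `C`, and fullness puts the extension in `P`.
    obtain ⟨y, rfl⟩ := Ext.contravariant_sequence_exact₃ hS Y x hx (add_zero 1)
    obtain ⟨f, rfl⟩ := (Ext.mk₀_bijective _ _).surjective y
    obtain ⟨l, hl⟩ := Ext.exists_extension_of_subsingleton (map_ι_shortExact hS) hE f.hom
    obtain rfl : S.f ≫ P.homMk l = f := P.hom_ext hl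
    rw [← Ext.mk₀_comp_mk₀]
    exact hS.extClass_comp_assoc _
  | succ n ih =>
    refine subsingleton_of_forall_eq 0 fun x ↦ ?_
    obtain ⟨F, p, hp, hx⟩ := Ext.exists_epi_comp_eq_zero x
    -- Refining the effacing cover to an object of `W` makes the Ext of the new kernel vanish in `C`
    -- one degree lower, as the induction requires.
    obtain ⟨X, q, hX, hq⟩ := hgen F
    let S : ShortComplex P.FullSubcategory := .mk _ _ (kernel.condition (q ≫ p))
    have hS : S.ShortExact := .mk' (ShortComplex.exact_kernel _) inferInstance
      (inferInstanceAs (Epi (q ≫ p)))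
    obtain ⟨y, rfl⟩ := Ext.contravariant_sequence_exact₃ hS Y x (by
      change (Ext.mk₀ (q ≫ p)).comp x _ = 0
      rw [← Ext.mk₀_comp_mk₀_assoc, hx, Ext.comp_zero]) (add_comm 1 (n + 1))
    have := ih (by lia) (Ext.subsingleton_X₁ (map_ι_shortExact hS)
      (hY X.obj hX (n + 1) (by lia) (by lia)) hE)
    rw [Subsingleton.elim y 0, Ext.comp_zero]

end Ext

end FullSubcategory

variable {M W : ObjectProperty C} {n : ℕ}

lemma IsDWide.isClusterTilting (hM : IsClusterTilting M (n + 1)) (hW : IsDWide M W (n + 1))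
    [IsWide (IsPresented W)] :
    IsClusterTilting (W.inverseImage (IsPresented W).ι) (n + 1) := by
  have := hW.containsZero
  have := hW.isStableUnderRetracts
  let := HasExt.standard C
  let := HasExt.standard (IsPresented W).FullSubcategory
  have hWB : W ≤ IsPresented W := fun X hX ↦ .of_mem hX
  have hgen (E : (IsPresented W).FullSubcategory) : ∃ (X : (IsPresented W).FullSubcategory)
      (p : X ⟶ E), W X.obj ∧ Epi p ∧ ∀ (X' : (IsPresented W).FullSubcategory) (g : X' ⟶ E),
        W X'.obj → ∃ h : X' ⟶ X, h ≫ p = g := by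
    obtain ⟨X, p, hX, hp, h⟩ := hW.exists_right_approximation hM E.property
    refine ⟨⟨X, hWB _ hX⟩, ObjectProperty.homMk p, hX,
      (IsPresented W).ι.epi_of_epi_map hp, fun X' g hX' ↦ ?_⟩
    obtain ⟨l, hl⟩ := h _ hX' g.hom
    exact ⟨ObjectProperty.homMk l, ObjectProperty.hom_ext _ hl⟩
  have hcogen (E : (IsPresented W).FullSubcategory) : ∃ (X : (IsPresented W).FullSubcategory)
      (i : E ⟶ X), W X.obj ∧ Mono i ∧ ∀ (X' : (IsPresented W).FullSubcategory) (g : E ⟶ X'),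
        W X'.obj → ∃ h : X ⟶ X', i ≫ h = g := by
    obtain ⟨X, i, hX, hi, h⟩ := hW.exists_left_approximation hM E.property
    refine ⟨⟨X, hWB _ hX⟩, ObjectProperty.homMk i, hX,
      (IsPresented W).ι.mono_of_mono_map hi, fun X' g hX' ↦ ?_⟩
    obtain ⟨l, hl⟩ := h _ hX' g.hom
    exact ⟨ObjectProperty.homMk l, ObjectProperty.hom_ext _ hl⟩
  have hext (X Y : (IsPresented W).FullSubcategory) (hX : W X.obj) (hY : W Y.obj) (i : ℕ)
      (hi : 0 < i) (hi' : i < n + 1) : ExtVanishes X Y i := by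
    obtain ⟨i, rfl⟩ := Nat.exists_eq_succ_of_ne_zero hi.ne'
    exact subsingleton_ext_fullSubcategory (W := W)
      (fun E ↦ by obtain ⟨X, p, hX, hp, -⟩ := hgen E; exact ⟨X, p, hX, hp⟩)
      (fun X hX ↦ hW.subsingleton_ext hM hX hY) hi' (hW.subsingleton_ext hM hX hY _ hi hi')
  refine ⟨fun E ↦ ?_, fun E ↦ ?_, fun E ↦ ?_, fun E ↦ ?_, fun E ↦ ⟨fun hE X hX ↦ hext E X hE hX,
    fun hE ↦ ?_⟩, fun E ↦ ⟨fun hE X hX ↦ hext X E hX hE, fun hE ↦ ?_⟩⟩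
  · obtain ⟨X, p, hX, hp, -⟩ := hgen E
    exact ⟨X, p, hX, hp⟩
  · obtain ⟨X, i, hX, hi, -⟩ := hcogen E
    exact ⟨X, i, hX, hi⟩
  · obtain ⟨X, p, hX, -, h⟩ := hgen E
    exact ⟨X, p, hX, h⟩
  · obtain ⟨X, i, hX, -, h⟩ := hcogen E
    exact ⟨X, i, hX, h⟩
  · obtain ⟨X, p, hX, -, h⟩ := (((hW.isPresented_iff_hasResolution hM).1
      E.property).fullSubcategory hWB).exists_approximation
    -- Lifting the identity along the approximation exhibits `E` as a retract of an object of `W`.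
    obtain ⟨s, hs⟩ := h E hE (𝟙 E)
    exact W.prop_of_retract ((Retract.mk s p hs).map (IsPresented W).ι) hX
  · obtain ⟨X, i, hX, -, h⟩ := (((hW.isPresented_iff_hasCoresolution hM).1
      E.property).fullSubcategory hWB).exists_approximation
    obtain ⟨r, hr⟩ := h E hE (𝟙 E)
    exact W.prop_of_retract ((Retract.mk i r hr).map (IsPresented W).ι) hX

/-- A wide subcategory in which `W` is cluster tilting consists of the cokernels of morphisms in
`W`. -/
lemma IsWideWithClusterTilting.eq_isPresented {B : ObjectProperty C} {d : ℕ}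
    (hB : IsWideWithClusterTilting B W d) : B = IsPresented W := by
  obtain ⟨_, hWB, hct⟩ := hB
  ext E
  refine ⟨fun hE ↦ ?_, fun ⟨X, Y, f, g, w, hex, hg, hX, hY⟩ ↦
    B.prop_of_isColimit_cokernelCofork hex.gIsCokernel (hWB _ hX) (hWB _ hY)⟩
  -- Covering `E`, then the kernel of the cover, gives a presentation; it stays exact in `C` because
  -- the inclusion of `B` is exact.
  obtain ⟨Y, p, hY, hp⟩ := hct.generating ⟨E, hE⟩
  obtain ⟨X, q, hX, hq⟩ := hct.generating (kernel p)
  have hS : (ShortComplex.mk _ _ (kernel.condition p)).ShortExact :=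
    .mk' (ShortComplex.exact_kernel p) inferInstance hp
  have := B.preservesEpimorphisms_ι_of_isNormalMonoCategory
  obtain ⟨w, h⟩ := exact_epi_comp (map_ι_shortExact hS).exact (B.ι.map q)
  exact ⟨_, _, _, _, w, h, (map_ι_shortExact hS).epi_g, hX, hY⟩

lemma IsDWide.isWideWithClusterTilting (hM : IsClusterTilting M (n + 1))
    (hW : IsDWide M W (n + 1)) : IsWideWithClusterTilting (IsPresented W) W (n + 1) := by
  have := hW.containsZero
  have := hW.isWide hM
  exact ⟨this, fun X hX ↦ .of_mem hX, hW.isClusterTilting hM⟩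

end HigherWide

theorem theorem4p10 {A : Type u} [Category.{v} A] [Abelian A] (d : ℕ) (hd : 1 ≤ d)
    (M : ObjectProperty A) (hM : HigherWide.IsClusterTilting M d)
    (W : ObjectProperty A) (hW : HigherWide.IsDWide M W d) :
    ∃ B : ObjectProperty A,
      (HigherWide.IsWideWithClusterTilting B W d ∧
        ∀ B' : ObjectProperty A, HigherWide.IsWideWithClusterTilting B' W d → B' = B) ∧
      B = HigherWide.resolvable W d ∧
      B = HigherWide.coresolvable W d := by
  obtain ⟨n, rfl⟩ : ∃ n, d = n + 1 := ⟨d - 1, by lia⟩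
  refine ⟨HigherWide.IsPresented W, ⟨hW.isWideWithClusterTilting hM, fun B' hB' ↦
    hB'.eq_isPresented⟩, ?_, ?_⟩
  · ext E
    rw [hW.isPresented_iff_hasResolution hM]
    exact ⟨HigherWide.HasResolution.resolvable, HigherWide.hasResolution_of_resolvable⟩
  · ext E
    rw [hW.isPresented_iff_hasCoresolution hM]
    exact ⟨HigherWide.HasCoresolution.coresolvable, HigherWide.hasCoresolution_of_coresolvable⟩
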